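/- Let $\mathcal H$ be a complex Hilbert space (inner product antilinear in the first argument), $\mathcal H\otimes\mathcal H$ its Hilbert space tensor square, and $F(v\otimes w)=w\otimes v$ the tensor flip. Let $H\subset\mathcal H$ be a standard subspace, i.e. a closed real linear subspace with $H\cap iH=\{0\}$ and $\overline{H+iH}=\mathcal H$; let $S_H:H+iH\to H+iH$, $h_1+ih_2\mapsto h_1-ih_2$, be its Tomita operator, $S_H^*$ the antilinear adjoint ($\langle S_H^*\psi,\varphi\rangle=\langle S_H\varphi,\psi\rangle$ for $\varphi\in\operatorname{dom}S_H$), and $\mathcal E(H)=\{V\in\mathcal B(\mathcal H): VH\subset H\}$ the set of endomorphisms of $H$. An operator $T\in\mathcal B(\mathcal H\otimes\mathcal H)$ is called $S_H$-crossable if there is a (necessarily unique) operator $\mathrm{Cr}_{S_H}(T)\in\mathcal B(\mathcal H\otimes\mathcal H)$ with $$\langle\varphi_2\otimes S_H^*\psi_2,\,T(S_H\varphi_1\otimes\psi_1)\rangle=\langle\varphi_1\otimes\varphi_2,\,\mathrm{Cr}_{S_H}(T)(\psi_1\otimes\psi_2)\rangle$$ for all $\varphi_1,\psi_1\in\operatorname{dom}S_H$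 and $\varphi_2,\psi_2\in\operatorname{dom}S_H^*$; it is called $S_H$-crossing symmetric if it is $S_H$-crossable and $\mathrm{Cr}_{S_H}(T)=T^*$. Let $E$ be a projection-valued measure on the Borel $\sigma$-algebra of $\mathbb R$ with values in the orthogonal projections of $\mathcal H$. A map $A:\operatorname{supp}(E)\to\mathcal B(\mathcal H)$ is called integrable with respect to $E\otimes 1$ if, for all $\psi,\xi,\eta\in\mathcal H$, the function $\lambda\mapsto\langle\xi,A(\lambda)\eta\rangle$ is integrable with respect to the measure $\mu_\psi=\langle\psi,E(\cdot)\psi\rangle$, and $$\sigma(\psi_1\otimes\psi_2,\psi_3\otimes\psi_4)=\int\langle\psi_1,dE_\lambda\psi_3\rangle\,\langle\psi_2,A(\lambda)\psi_4\rangle$$ (defined by polarization from the measures $\mu_\psi$) extends to a bounded sesquilinear form on $\mathcal H\otimes\mathcal H$. In this case $\int dE_\lambda\otimes A(\lambda)\in\mathcal B(\mathcal H\otimes\mathcal H)$ denotes the unique bounded operator with $\langle\Phi,(\int dE_\lambda\otimes A(\lambda))\Psi\rangle=\sigma(\Phi,\Psi)$ for all $\Phi,\Psi$. Let $V:\operatorname{supp}(E)\to\mathcal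 E(H)$ be integrable with respect to $E\otimes 1$. Then $$T:=\Big(\int dE_\lambda\otimes V(\lambda)\Big)F\in\mathcal B(\mathcal H\otimes\mathcal H)$$ is $S_H$-crossing symmetric. -/

import Mathlib

open MeasureTheory Set Function
open scoped ComplexInnerProductSpace TensorProduct

noncomputable section

/-! ### Closed antilinear involutions and their adjoints -/

/-- A densely defined closed antilinear involution `S : dom S → dom S`, `S ∘ S = id`, on a complex
Hilbert space. -/
structure ClosedAntilinearInvolution (H : Type*) [NormedAddCommGroup H] [InnerProductSpace ℂ H]
    extends H →ₛₗ.[starRingEnd ℂ] H where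
  /-- The domain is dense. -/
  dense_domain : Dense (domain : Set H)
  /-- The graph is closed. -/
  isClosed_graph : IsClosed {p : H × H | ∃ x : domain, p = ((x : H), toFun x)}
  /-- The map takes its domain to its domain. -/
  map_mem_domain : ∀ x : domain, toFun x ∈ domain
  /-- The map is an involution. -/
  involutive : ∀ x : domain, toFun ⟨toFun x, map_mem_domain x⟩ = x

namespace ClosedAntilinearInvolution

variable {H : Type*} [NormedAddCommGroup H] [InnerProductSpace ℂ H]

/-- A vector is determined by its inner products with the vectors of the domain. -/
theorem eq_of_inner_domain (S : ClosedAntilinearInvolution H) {χ χ' : H}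
    (h : ∀ φ : S.domain, ⟪χ, (φ : H)⟫ = ⟪χ', (φ : H)⟫) : χ = χ' := by
  refine S.dense_domain.eq_of_inner_left (𝕜 := ℂ) fun v hv => ?_
  exact h ⟨v, hv⟩

/-- The domain of the adjoint `S*` : all `ψ` for which there is `χ` (which is then `S* ψ`) with
`⟪χ, φ⟫ = ⟪S φ, ψ⟫` for all `φ ∈ dom S`. -/
def adjointDomain (S : ClosedAntilinearInvolution H) : Submodule ℂ H where
  carrier := {ψ | ∃ χ : H, ∀ φ : S.domain, ⟪χ, (φ : H)⟫ = ⟪S.toFun φ, ψ⟫}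
  zero_mem' := ⟨0, fun φ => by simp⟩
  add_mem' := by
    rintro a b ⟨χ, hχ⟩ ⟨χ', hχ'⟩
    exact ⟨χ + χ', fun φ => by rw [inner_add_left, inner_add_right, hχ, hχ']⟩
  smul_mem' := by
    rintro c a ⟨χ, hχ⟩
    exact ⟨(starRingEnd ℂ) c • χ, fun φ => by
      rw [inner_smul_left, inner_smul_right, hχ, Complex.conj_conj]⟩

theorem exists_adjoint (S : ClosedAntilinearInvolution H) (ψ : S.adjointDomain) :
    ∃ χ : H, ∀ φ : S.domain, ⟪χ, (φ : H)⟫ = ⟪S.toFun φ, (ψ : H)⟫ := ψ.2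

/-- The antilinear adjoint `S*` of `S`, an antilinear operator on `adjointDomain S`. -/
def adjoint (S : ClosedAntilinearInvolution H) : H →ₛₗ.[starRingEnd ℂ] H where
  domain := S.adjointDomain
  toFun :=
    { toFun := fun ψ => (S.exists_adjoint ψ).choose
      map_add' := fun ψ ψ' => S.eq_of_inner_domain fun φ => by
        rw [(S.exists_adjoint (ψ + ψ')).choose_spec, inner_add_left,
          (S.exists_adjoint ψ).choose_spec, (S.exists_adjoint ψ').choose_spec,
          Submodule.coe_add, inner_add_right]
      map_smul' := fun c ψ => S.eq_of_inner_domain fun φ => by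
        rw [(S.exists_adjoint (c • ψ)).choose_spec, inner_smul_left,
          (S.exists_adjoint ψ).choose_spec, Submodule.coe_smul, inner_smul_right,
          Complex.conj_conj] }

/-- The defining relation of the adjoint: `⟪S* ψ, φ⟫ = ⟪S φ, ψ⟫`. -/
theorem adjoint_inner (S : ClosedAntilinearInvolution H) (ψ : S.adjoint.domain) (φ : S.domain) :
    ⟪S.adjoint ψ, (φ : H)⟫ = ⟪S.toFun φ, (ψ : H)⟫ :=
  (S.exists_adjoint ψ).choose_spec φ

end ClosedAntilinearInvolution

/-! ### The Tomita operator of a standard subspace and its endomorphisms -/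

namespace StandardSubspace

variable {H : Type*} [NormedAddCommGroup H] [InnerProductSpace ℂ H]

theorem sub_mem (K : StandardSubspace H) {a b : H} (ha : a ∈ K.toClosedSubmodule)
    (hb : b ∈ K.toClosedSubmodule) : a - b ∈ K.toClosedSubmodule :=
  K.toClosedSubmodule.toSubmodule.sub_mem ha hb

theorem neg_mem (K : StandardSubspace H) {a : H} (ha : a ∈ K.toClosedSubmodule) :
    -a ∈ K.toClosedSubmodule :=
  K.toClosedSubmodule.toSubmodule.neg_mem ha

/-- The decomposition `h₁ + i h₂` with `h₁, h₂` in a standard subspace is unique. -/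
theorem decomp_unique (K : StandardSubspace H) {a b a' b' : H}
    (ha : a ∈ K.toClosedSubmodule) (hb : b ∈ K.toClosedSubmodule)
    (ha' : a' ∈ K.toClosedSubmodule) (hb' : b' ∈ K.toClosedSubmodule)
    (h : a + Complex.I • b = a' + Complex.I • b') : a = a' ∧ b = b' := by
  have h1 : a - a' = Complex.I • (b' - b) := by
    rw [smul_sub, sub_eq_sub_iff_add_eq_add, h, add_comm]
  have h2 : a - a' ∈ K.toClosedSubmodule ⊓ K.toClosedSubmodule.mulI := by
    refine ⟨K.sub_mem ha ha', ?_⟩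
    change a - a' ∈ K.toClosedSubmodule.mulI
    rw [ClosedSubmodule.mem_mapEquiv_iff, h1]
    simpa [Units.smul_def, smul_smul] using K.sub_mem hb' hb
  rw [K.IsSeparating, ClosedSubmodule.mem_bot] at h2
  have h3 : b' - b = 0 := by
    have h4 : Complex.I • (b' - b) = 0 := by rw [← h1, h2]
    exact (smul_eq_zero.mp h4).resolve_left Complex.I_ne_zero
  exact ⟨sub_eq_zero.mp h2, (sub_eq_zero.mp h3).symm⟩

theorem real_smul_mem (K : StandardSubspace H) (r : ℝ) {a : H} (ha : a ∈ K.toClosedSubmodule) :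
    (r : ℂ) • a ∈ K.toClosedSubmodule := by
  rw [Complex.coe_smul]
  exact K.toClosedSubmodule.smul_mem r ha

theorem smul_decomp (c : ℂ) (a b : H) :
    c • (a + Complex.I • b) =
      ((c.re : ℂ) • a - (c.im : ℂ) • b) + Complex.I • ((c.im : ℂ) • a + (c.re : ℂ) • b) := by
  have hI : Complex.I * Complex.I = -1 := Complex.I_mul_I
  conv_lhs => rw [← Complex.re_add_im c]
  match_scalars
  · ring
  · linear_combination (c.im : ℂ) * hI

theorem conj_smul_decomp (c : ℂ) (a b : H) :
    (starRingEnd ℂ) c • (a - Complex.I • b) =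
      ((c.re : ℂ) • a - (c.im : ℂ) • b) - Complex.I • ((c.im : ℂ) • a + (c.re : ℂ) • b) := by
  have hI : Complex.I * Complex.I = -1 := Complex.I_mul_I
  have hc : (starRingEnd ℂ) c = (c.re : ℂ) - (c.im : ℂ) * Complex.I := by
    apply Complex.ext <;> simp
  rw [hc]
  match_scalars
  · ring
  · linear_combination (c.im : ℂ) * hI

/-- The complex subspace `K + iK`. -/
def tomitaDomain (K : StandardSubspace H) : Submodule ℂ H where
  carrier := {x | ∃ h₁ ∈ K.toClosedSubmodule, ∃ h₂ ∈ K.toClosedSubmodule,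
    x = h₁ + Complex.I • h₂}
  zero_mem' := ⟨0, zero_mem _, 0, zero_mem _, by simp⟩
  add_mem' := by
    rintro _ _ ⟨a, ha, b, hb, rfl⟩ ⟨a', ha', b', hb', rfl⟩
    exact ⟨a + a', add_mem ha ha', b + b', add_mem hb hb', by rw [smul_add]; abel⟩
  smul_mem' := by
    rintro c _ ⟨a, ha, b, hb, rfl⟩
    exact ⟨_, K.sub_mem (K.real_smul_mem _ ha) (K.real_smul_mem _ hb), _,
      add_mem (K.real_smul_mem _ ha) (K.real_smul_mem _ hb), smul_decomp c a b⟩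

theorem exists_tomita (K : StandardSubspace H) (x : K.tomitaDomain) :
    ∃ y : H, ∃ h₁ ∈ K.toClosedSubmodule, ∃ h₂ ∈ K.toClosedSubmodule,
      (x : H) = h₁ + Complex.I • h₂ ∧ y = h₁ - Complex.I • h₂ := by
  obtain ⟨a, ha, b, hb, h⟩ := x.2
  exact ⟨_, a, ha, b, hb, h, rfl⟩

/-- The map `h₁ + i h₂ ↦ h₁ - i h₂` on `K + iK`. -/
def tomitaFun (K : StandardSubspace H) (x : K.tomitaDomain) : H := (K.exists_tomita x).choose

theorem tomitaFun_eq (K : StandardSubspace H) (x : K.tomitaDomain) {a b : H}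
    (ha : a ∈ K.toClosedSubmodule) (hb : b ∈ K.toClosedSubmodule)
    (hx : (x : H) = a + Complex.I • b) : K.tomitaFun x = a - Complex.I • b := by
  obtain ⟨a', ha', b', hb', h, hy⟩ := (K.exists_tomita x).choose_spec
  obtain ⟨rfl, rfl⟩ := K.decomp_unique ha hb ha' hb' (hx.symm.trans h)
  exact hy

/-- The Tomita operator `S_K : K + iK → K + iK`, `h₁ + i h₂ ↦ h₁ - i h₂`, of a standard
subspace `K`. -/
def tomita (K : StandardSubspace H) : ClosedAntilinearInvolution H where
  domain := K.tomitaDomain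
  toFun :=
    { toFun := K.tomitaFun
      map_add' := fun x y => by
        obtain ⟨a, ha, b, hb, hx⟩ := x.2
        obtain ⟨a', ha', b', hb', hy⟩ := y.2
        rw [K.tomitaFun_eq x ha hb hx, K.tomitaFun_eq y ha' hb' hy,
          K.tomitaFun_eq (x + y) (add_mem ha ha') (add_mem hb hb')
            (by rw [Submodule.coe_add, hx, hy, smul_add]; abel), smul_add]
        abel
      map_smul' := fun c x => by
        obtain ⟨a, ha, b, hb, hx⟩ := x.2
        rw [K.tomitaFun_eq x ha hb hx, conj_smul_decomp]
        exact K.tomitaFun_eq _ (K.sub_mem (K.real_smul_mem _ ha) (K.real_smul_mem _ hb))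
          (add_mem (K.real_smul_mem _ ha) (K.real_smul_mem _ hb))
          (by rw [Submodule.coe_smul, hx, smul_decomp]) }
  dense_domain := by
    have h1 : (K.toClosedSubmodule ⊔ K.toClosedSubmodule.mulI : ClosedSubmodule ℝ H) ≤
        (K.tomitaDomain.restrictScalars ℝ).closure := by
      refine sup_le (fun x hx => subset_closure ?_) (fun x hx => subset_closure ?_)
      · exact ⟨x, hx, 0, zero_mem _, by simp⟩
      · have hx' : x ∈ K.toClosedSubmodule.mulI := hx
        rw [ClosedSubmodule.mem_mapEquiv_iff] at hx'
        refine ⟨0, zero_mem _, _, hx', ?_⟩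
        simp [Units.smul_def, smul_smul]
    rw [K.IsCyclic] at h1
    intro x
    exact h1 (show x ∈ (⊤ : ClosedSubmodule ℝ H) from trivial)
  isClosed_graph := by
    have hK : IsClosed (K.toClosedSubmodule : Set H) := K.toClosedSubmodule.isClosed
    have key : {p : H × H | ∃ x : K.tomitaDomain, p = ((x : H), K.tomitaFun x)} =
        {p : H × H | (2⁻¹ : ℂ) • (p.1 + p.2) ∈ K.toClosedSubmodule ∧
          (-Complex.I * 2⁻¹) • (p.1 - p.2) ∈ K.toClosedSubmodule} := by
      have hI : Complex.I * Complex.I = -1 := Complex.I_mul_I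
      ext ⟨p, q⟩
      constructor
      · rintro ⟨⟨_, a, ha, b, hb, rfl⟩, hx⟩
        rw [K.tomitaFun_eq _ ha hb rfl, Prod.mk.injEq] at hx
        obtain ⟨rfl, rfl⟩ := hx
        constructor
        · convert ha using 1
          dsimp only
          match_scalars <;> ring
        · convert hb using 1
          dsimp only
          match_scalars
          · ring
          · linear_combination -hI
      · rintro ⟨h1, h2⟩
        dsimp only at h1 h2
        have hp : p = (2⁻¹ : ℂ) • (p + q) + Complex.I • ((-Complex.I * 2⁻¹) • (p - q)) := by
          match_scalars
          · linear_combination (2⁻¹ : ℂ) * hI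
          · linear_combination (-(2⁻¹ : ℂ)) * hI
        refine ⟨⟨p, _, h1, _, h2, hp⟩, ?_⟩
        rw [K.tomitaFun_eq _ h1 h2 hp, Prod.mk.injEq]
        refine ⟨rfl, ?_⟩
        match_scalars
        · linear_combination (2⁻¹ : ℂ) * hI
        · linear_combination (-(2⁻¹ : ℂ)) * hI
    change IsClosed {p : H × H | ∃ x : K.tomitaDomain, p = ((x : H), K.tomitaFun x)}
    rw [key]
    exact (hK.preimage (by fun_prop)).inter (hK.preimage (by fun_prop))
  map_mem_domain := by
    rintro ⟨_, a, ha, b, hb, rfl⟩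
    exact ⟨a, ha, -b, K.neg_mem hb,
      (K.tomitaFun_eq _ ha hb rfl).trans (by rw [smul_neg, sub_eq_add_neg])⟩
  involutive := by
    rintro ⟨_, a, ha, b, hb, rfl⟩
    refine (K.tomitaFun_eq _ ha (K.neg_mem hb) ?_).trans (by rw [smul_neg, sub_neg_eq_add])
    exact (K.tomitaFun_eq _ ha hb rfl).trans (by rw [smul_neg, sub_eq_add_neg])

/-- The endomorphisms of a standard subspace `K`: the bounded (complex linear) operators `V` on the
whole Hilbert space with `V K ⊆ K`. -/
def endomorphisms (K : StandardSubspace H) : Set (H →L[ℂ] H) :=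
  {V | ∀ h ∈ K.toClosedSubmodule, V h ∈ K.toClosedSubmodule}

end StandardSubspace

/-! ### The Hilbert space tensor square and the tensor flip -/

/-- The Hilbert space tensor square: the completion of the algebraic tensor square. -/
abbrev TensorSquare (H : Type*) [NormedAddCommGroup H] [InnerProductSpace ℂ H] : Type _ :=
  UniformSpace.Completion (H ⊗[ℂ] H)

/-- The elementary tensor `x ⊗ y` in the Hilbert space tensor square. -/
def pureTensor {H : Type*} [NormedAddCommGroup H] [InnerProductSpace ℂ H] (x y : H) :
    TensorSquare H := ((x ⊗ₜ[ℂ] y : H ⊗[ℂ] H) : UniformSpace.Completion (H ⊗[ℂ] H))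

/-- The tensor flip, `x ⊗ y ↦ y ⊗ x`. -/
def tensorFlip (H : Type*) [NormedAddCommGroup H] [InnerProductSpace ℂ H] :
    TensorSquare H →L[ℂ] TensorSquare H :=
  ((TensorProduct.commIsometry ℂ H H : H ⊗[ℂ] H ≃L[ℂ] H ⊗[ℂ] H) :
    H ⊗[ℂ] H →L[ℂ] H ⊗[ℂ] H).completion

theorem tensorFlip_pureTensor {H : Type*} [NormedAddCommGroup H] [InnerProductSpace ℂ H]
    (x y : H) : tensorFlip H (pureTensor x y) = pureTensor y x := by
  simp [tensorFlip, pureTensor]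

/-! ### The crossing map -/

namespace ClosedAntilinearInvolution

variable {H : Type*} [NormedAddCommGroup H] [InnerProductSpace ℂ H]

/-- The form `Q_S(T)(φ₁ ⊗ φ₂, ψ₁ ⊗ ψ₂) = ⟪φ₂ ⊗ S* ψ₂, T (S φ₁ ⊗ ψ₁)⟫` on elementary tensors of
vectors `φ₁, ψ₁ ∈ dom S` and `φ₂, ψ₂ ∈ dom S*`. -/
def crossingForm (S : ClosedAntilinearInvolution H) (T : TensorSquare H →L[ℂ] TensorSquare H)
    (φ₁ : S.domain) (φ₂ : S.adjoint.domain) (ψ₁ : S.domain) (ψ₂ : S.adjoint.domain) : ℂ :=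
  ⟪pureTensor (φ₂ : H) (S.adjoint ψ₂), T (pureTensor (S.toFun φ₁) (ψ₁ : H))⟫

/-- `T` is `S`-crossable if some bounded operator represents the form `Q_S(T)`. -/
def IsCrossable (S : ClosedAntilinearInvolution H)
    (T : TensorSquare H →L[ℂ] TensorSquare H) : Prop :=
  ∃ C : TensorSquare H →L[ℂ] TensorSquare H,
    ∀ (φ₁ : S.domain) (φ₂ : S.adjoint.domain) (ψ₁ : S.domain) (ψ₂ : S.adjoint.domain),
      S.crossingForm T φ₁ φ₂ ψ₁ ψ₂ =
        ⟪pureTensor (φ₁ : H) (φ₂ : H), C (pureTensor (ψ₁ : H) (ψ₂ : H))⟫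

/-- The `S`-crossing map, which sends an `S`-crossable operator to the bounded operator that
represents the form `Q_S(T)`. -/
def crossingMap (S : ClosedAntilinearInvolution H)
    (T : {T : TensorSquare H →L[ℂ] TensorSquare H // S.IsCrossable T}) :
    TensorSquare H →L[ℂ] TensorSquare H := T.2.choose

/-- `T` is `S`-crossing symmetric if it is `S`-crossable and the crossing map sends it to its
adjoint. -/
def IsCrossingSymmetric (S : ClosedAntilinearInvolution H)
    (T : TensorSquare H →L[ℂ] TensorSquare H) : Prop :=
  ∃ hT : S.IsCrossable T, S.crossingMap ⟨T, hT⟩ = ContinuousLinearMap.adjoint T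

end ClosedAntilinearInvolution

/-! ### Projection-valued measures and operator-valued integrals -/

/-- A projection-valued measure on the Borel `σ`-algebra of `ℝ`: `E B` is an orthogonal projection
for every Borel set `B`, `E ℝ = 1`, and `E` is `σ`-additive in the strong operator topology. -/
structure ProjectionValuedMeasure (H : Type*) [NormedAddCommGroup H] [InnerProductSpace ℂ H]
    [CompleteSpace H] where
  /-- The projection attached to a set (only Borel sets matter). -/
  toFun : Set ℝ → H →L[ℂ] H
  isStarProjection : ∀ B : Set ℝ, MeasurableSet B → IsStarProjection (toFun B)
  map_univ : toFun univ = 1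
  hasSum_iUnion : ∀ B : ℕ → Set ℝ, (∀ n, MeasurableSet (B n)) → Pairwise (Disjoint on B) →
    ∀ ψ : H, HasSum (fun n => toFun (B n) ψ) (toFun (⋃ n, B n) ψ)

namespace ProjectionValuedMeasure

variable {H : Type*} [NormedAddCommGroup H] [InnerProductSpace ℂ H] [CompleteSpace H]

theorem map_empty (E : ProjectionValuedMeasure H) : E.toFun ∅ = 0 := by
  ext ψ
  have h := E.hasSum_iUnion (fun _ => ∅) (fun _ => MeasurableSet.empty)
    (fun i j _ => disjoint_bot_left) ψ
  simpa [summable_const_iff] using h.summable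

theorem re_inner_eq_norm_sq (E : ProjectionValuedMeasure H) {B : Set ℝ} (hB : MeasurableSet B)
    (ψ : H) : (⟪ψ, E.toFun B ψ⟫).re = ‖E.toFun B ψ‖ ^ 2 := by
  have h := E.isStarProjection B hB
  have h1 : E.toFun B (E.toFun B ψ) = E.toFun B ψ :=
    congrArg (fun A : H →L[ℂ] H => A ψ) h.isIdempotentElem
  have h2 : ContinuousLinearMap.adjoint (E.toFun B) = E.toFun B := h.isSelfAdjoint
  have h3 : ⟪ψ, E.toFun B ψ⟫ = ⟪E.toFun B ψ, E.toFun B ψ⟫ := by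
    conv_lhs => rw [← h1, ← ContinuousLinearMap.adjoint_inner_left, h2]
  rw [h3, inner_self_eq_norm_sq_to_K]
  norm_cast

/-- The positive Borel measure `μ_ψ = ⟪ψ, E(·) ψ⟫`. -/
def scalarMeasure (E : ProjectionValuedMeasure H) (ψ : H) : Measure ℝ :=
  Measure.ofMeasurable (fun B _ => ENNReal.ofReal (⟪ψ, E.toFun B ψ⟫).re)
    (by simp [E.map_empty])
    (by
      intro B hB hd
      have h := (E.hasSum_iUnion B hB hd ψ).mapL (innerSL ℂ ψ)
      have h' := Complex.hasSum_re h
      have hs : HasSum (fun n => (⟪ψ, E.toFun (B n) ψ⟫).re) (⟪ψ, E.toFun (⋃ n, B n) ψ⟫).re := h'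
      rw [← hs.tsum_eq, ENNReal.ofReal_tsum_of_nonneg _ hs.summable]
      intro n
      rw [E.re_inner_eq_norm_sq (hB n)]
      positivity)

/-- The support of `E`: the points all of whose open neighbourhoods have nonzero projection. -/
def support (E : ProjectionValuedMeasure H) : Set ℝ :=
  {x | ∀ U : Set ℝ, IsOpen U → x ∈ U → E.toFun U ≠ 0}

/-- The restriction of `μ_ψ` to the support of `E`, as a measure on the subtype. -/
def supportMeasure (E : ProjectionValuedMeasure H) (ψ : H) : Measure E.support :=
  (E.scalarMeasure ψ).comap Subtype.val

/-- The integral `∫ f(x) ⟪ψ₁, dE_x ψ₂⟫` over the support of `E`, defined by polarization. -/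
def sesqIntegral (E : ProjectionValuedMeasure H) (f : E.support → ℂ) (ψ₁ ψ₂ : H) : ℂ :=
  (∫ x, f x ∂E.supportMeasure (ψ₂ + ψ₁) - ∫ x, f x ∂E.supportMeasure (ψ₂ - ψ₁)
    + Complex.I * ∫ x, f x ∂E.supportMeasure (ψ₂ + Complex.I • ψ₁)
    - Complex.I * ∫ x, f x ∂E.supportMeasure (ψ₂ - Complex.I • ψ₁)) / 4

/-- The bounded sesquilinear form `σ` extends
`σ(ψ₁ ⊗ ψ₂, ψ₃ ⊗ ψ₄) = ∫ ⟪ψ₁, dE_x ψ₃⟫ ⟪ψ₂, A(x) ψ₄⟫`. -/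
def IsTensorForm (E : ProjectionValuedMeasure H) (A : E.support → H →L[ℂ] H)
    (σ : TensorSquare H →L⋆[ℂ] TensorSquare H →L[ℂ] ℂ) : Prop :=
  ∀ ψ₁ ψ₂ ψ₃ ψ₄ : H, σ (pureTensor ψ₁ ψ₂) (pureTensor ψ₃ ψ₄) =
    E.sesqIntegral (fun x => ⟪ψ₂, A x ψ₄⟫) ψ₁ ψ₃

/-- `A : supp E → B(H)` is integrable with respect to `E ⊗ 1`: it is weakly integrable with respect
to every `μ_ψ`, and the form `∫ ⟪ψ₁, dE_x ψ₃⟫ ⟪ψ₂, A(x) ψ₄⟫` extends to a bounded sesquilinear form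
on the Hilbert space tensor square. -/
structure TensorIntegrable (E : ProjectionValuedMeasure H) (A : E.support → H →L[ℂ] H) :
    Prop where
  weakly_integrable : ∀ ψ ξ η : H, Integrable (fun x => ⟪ξ, A x η⟫) (E.supportMeasure ψ)
  exists_form : ∃ σ : TensorSquare H →L⋆[ℂ] TensorSquare H →L[ℂ] ℂ, E.IsTensorForm A σ

/-- The operator `T = ∫ dE_x ⊗ A(x)` with `⟪Φ, T Ψ⟫ = σ(Φ, Ψ)`, where `σ` is the bounded
sesquilinear form of `A`. -/
def tensorIntegral (E : ProjectionValuedMeasure H) (A : E.support → H →L[ℂ] H)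
    (hA : E.TensorIntegrable A) : TensorSquare H →L[ℂ] TensorSquare H :=
  ContinuousLinearMap.adjoint (InnerProductSpace.continuousLinearMapOfBilin hA.exists_form.choose)

/-- The defining property of `∫ dE_x ⊗ A(x)` on elementary tensors. -/
theorem inner_tensorIntegral (E : ProjectionValuedMeasure H) (A : E.support → H →L[ℂ] H)
    (hA : E.TensorIntegrable A) (ψ₁ ψ₂ ψ₃ ψ₄ : H) :
    ⟪pureTensor ψ₁ ψ₂, E.tensorIntegral A hA (pureTensor ψ₃ ψ₄)⟫ =
      E.sesqIntegral (fun x => ⟪ψ₂, A x ψ₄⟫) ψ₁ ψ₃ := by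
  rw [tensorIntegral, ContinuousLinearMap.adjoint_inner_right,
    InnerProductSpace.continuousLinearMapOfBilin_apply]
  exact hA.exists_form.choose_spec ψ₁ ψ₂ ψ₃ ψ₄

end ProjectionValuedMeasure

end

/-! Write `S` for the Tomita operator of `K`. The flip turns `⟪φ₂ ⊗ S*ψ₂, T (Sφ₁ ⊗ ψ₁)⟫` into `∫
⟪φ₂, dE ψ₁⟫ ⟪S*ψ₂, V(x) Sφ₁⟫`. Each `V(x)` commutes with `S`, so moving `S*` across gives `⟪V(x) φ₁,
ψ₂⟫` under the integral (`inner_adjoint_map_tomita`). On the other side, `⟪φ₁ ⊗ φ₂, T* (ψ₁ ⊗ ψ₂)⟫`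
is the conjugate of `∫ ⟪ψ₁, dE φ₂⟫ ⟪ψ₂, V(x) φ₁⟫`, which is the same integral because the polarized
form is Hermitian (`conj_sesqIntegral`).

This shows that `T*` represents the crossing form. That it is the operator picked by `crossingMap`
needs uniqueness, hence density of `dom S*`: this domain contains `K' + iK'`, where the symplectic
complement `K'` is again standard. -/

/-! ### Tomita operators, their adjoints and endomorphisms -/

open ClosedSubmodule in
/-- The Tomita operator of the symplectic complement is contained in the adjoint of the Tomita
operator. -/
theorem StandardSubspace.tomitaDomain_symplComp_le_adjointDomain {H : Type*}
    [NormedAddCommGroup H] [InnerProductSpace ℂ H] [CompleteSpace H] (K : StandardSubspace H) :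
    K.symplComp.tomitaDomain ≤ K.tomita.adjointDomain := by
  have comm : ∀ h ∈ K.toClosedSubmodule, ∀ u ∈ K.symplComp.toClosedSubmodule,
      ⟪u, h⟫ = ⟪h, u⟫ := by
    intro h hh u hu
    rw [← inner_conj_symm]
    exact Complex.conj_eq_iff_im.mpr (mem_symplComp_iff.mp hu h hh)
  rintro _ ⟨a, ha, b, hb, rfl⟩
  -- The witness is the value at `a + ib` of the Tomita operator of `K'`; inner products between `K`
  -- and `K'` are real, so the four terms match.
  refine ⟨a - Complex.I • b, ?_⟩
  rintro ⟨_, h, hh, k, hk, rfl⟩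
  have hS : K.tomita.toFun ⟨h + Complex.I • k, h, hh, k, hk, rfl⟩ = h - Complex.I • k :=
    K.tomitaFun_eq _ hh hk rfl
  rw [hS]
  simp only [inner_add_right, inner_sub_left, inner_smul_left, inner_smul_right,
    comm h hh a ha, comm h hh b hb, comm k hk a ha, comm k hk b hb,
    Complex.conj_I]
  ring

/-- The adjoint of the Tomita operator is densely defined. -/
theorem StandardSubspace.dense_adjointDomain {H : Type*}
    [NormedAddCommGroup H] [InnerProductSpace ℂ H] [CompleteSpace H] (K : StandardSubspace H) :
    Dense (K.tomita.adjointDomain : Set H) :=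
  K.symplComp.tomita.dense_domain.mono K.tomitaDomain_symplComp_le_adjointDomain

/-- An endomorphism of a standard subspace preserves the domain of the Tomita operator. -/
theorem StandardSubspace.map_mem_tomita_domain {H : Type*} [NormedAddCommGroup H]
    [InnerProductSpace ℂ H] (K : StandardSubspace H) {V : H →L[ℂ] H} (hV : V ∈ K.endomorphisms)
    (φ : K.tomita.domain) : V φ ∈ K.tomita.domain := by
  obtain ⟨_, a, ha, b, hb, rfl⟩ := φ
  exact ⟨V a, hV a ha, V b, hV b hb, by simp⟩

/-- An endomorphism of a standard subspace commutes with the Tomita operator on its domain. -/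
theorem StandardSubspace.tomita_map {H : Type*} [NormedAddCommGroup H]
    [InnerProductSpace ℂ H] (K : StandardSubspace H) {V : H →L[ℂ] H} (hV : V ∈ K.endomorphisms)
    (φ : K.tomita.domain) :
    K.tomita.toFun ⟨V φ, K.map_mem_tomita_domain hV φ⟩ = V (K.tomita.toFun φ) := by
  obtain ⟨_, a, ha, b, hb, rfl⟩ := φ
  have h₁ : K.tomita.toFun ⟨a + Complex.I • b, a, ha, b, hb, rfl⟩ = a - Complex.I • b :=
    K.tomitaFun_eq _ ha hb rfl
  rw [h₁]
  refine (K.tomitaFun_eq _ (hV a ha) (hV b hb) (by simp)).trans (by simp)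

/-- The relation `⟪S* ψ, V S φ⟫ = ⟪V φ, ψ⟫` for an endomorphism `V`. -/
theorem StandardSubspace.inner_adjoint_map_tomita {H : Type*} [NormedAddCommGroup H]
    [InnerProductSpace ℂ H] (K : StandardSubspace H) {V : H →L[ℂ] H} (hV : V ∈ K.endomorphisms)
    (ψ : K.tomita.adjoint.domain) (φ : K.tomita.domain) :
    ⟪K.tomita.adjoint ψ, V (K.tomita.toFun φ)⟫ = ⟪V φ, (ψ : H)⟫ := by
  set x : K.tomita.domain := ⟨V φ, K.map_mem_tomita_domain hV φ⟩
  -- Pairing `S*ψ` with `S x`, where `x = V φ`, makes `S S x = x` appear on the right.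
  have h := K.tomita.adjoint_inner ψ ⟨K.tomita.toFun x, K.tomita.map_mem_domain x⟩
  rw [K.tomita.involutive x] at h
  rw [← K.tomita_map hV φ]
  exact h

/-! ### Hermitian symmetry of the spectral integral -/

namespace ProjectionValuedMeasure

variable {H : Type*} [NormedAddCommGroup H] [InnerProductSpace ℂ H] [CompleteSpace H]

/-- The measure is quadratic in the vector, so a phase contributes only `|c|² = 1`. This identifies
the polarization measures after the two arguments are exchanged. -/
theorem scalarMeasure_smul (E : ProjectionValuedMeasure H) {c : ℂ} (hc : ‖c‖ = 1) (ψ : H) :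
    E.scalarMeasure (c • ψ) = E.scalarMeasure ψ := by
  ext B hB
  have h : (starRingEnd ℂ) c * c = 1 := by simp [Complex.conj_mul', hc]
  simp only [scalarMeasure, Measure.ofMeasurable_apply _ hB, map_smul, inner_smul_left,
    inner_smul_right]
  rw [mul_left_comm, ← mul_assoc, h, one_mul]

theorem supportMeasure_smul (E : ProjectionValuedMeasure H) {c : ℂ} (hc : ‖c‖ = 1) (ψ : H) :
    E.supportMeasure (c • ψ) = E.supportMeasure ψ := by
  rw [supportMeasure, supportMeasure, E.scalarMeasure_smul hc]

/-- The polarized integral is Hermitian. -/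
theorem conj_sesqIntegral (E : ProjectionValuedMeasure H) (f : E.support → ℂ) (ψ₁ ψ₂ : H) :
    (starRingEnd ℂ) (E.sesqIntegral f ψ₁ ψ₂) =
      E.sesqIntegral (fun x => (starRingEnd ℂ) (f x)) ψ₂ ψ₁ := by
  have hI : Complex.I * Complex.I = -1 := Complex.I_mul_I
  have h₁ : E.supportMeasure (ψ₁ - ψ₂) = E.supportMeasure (ψ₂ - ψ₁) := by
    rw [← E.supportMeasure_smul (c := -1) (by simp) (ψ₂ - ψ₁)]
    simp
  have h₂ : E.supportMeasure (ψ₁ + Complex.I • ψ₂) =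
      E.supportMeasure (ψ₂ - Complex.I • ψ₁) := by
    rw [← E.supportMeasure_smul (c := Complex.I) (by simp) (ψ₂ - Complex.I • ψ₁)]
    simp [smul_sub, smul_smul, add_comm]
  have h₃ : E.supportMeasure (ψ₁ - Complex.I • ψ₂) =
      E.supportMeasure (ψ₂ + Complex.I • ψ₁) := by
    rw [← E.supportMeasure_smul (c := -Complex.I) (by simp) (ψ₂ + Complex.I • ψ₁)]
    simp [smul_add, smul_smul, sub_eq_add_neg, add_comm]
  -- Exchanging the arguments swaps the two terms with coefficients `±i`; conjugation of these
  -- coefficients compensates.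
  simp only [sesqIntegral, h₁, h₂, h₃, add_comm ψ₁ ψ₂, integral_conj, map_div₀, map_add, map_sub,
    map_mul, Complex.conj_I, map_ofNat]
  ring

end ProjectionValuedMeasure

/-! ### Density of elementary tensors and uniqueness of operators -/

theorem continuous_pureTensor {H : Type*} [NormedAddCommGroup H] [InnerProductSpace ℂ H] :
    Continuous fun p : H × H => pureTensor p.1 p.2 :=
  UniformSpace.Completion.continuous_coe _ |>.comp
    ((TensorProduct.mk ℂ H H).mkContinuous₂ 1 fun x y => by simp).continuous₂

theorem dense_span_pureTensor (H : Type*) [NormedAddCommGroup H] [InnerProductSpace ℂ H] :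
    Dense (Submodule.span ℂ (range fun p : H × H => pureTensor p.1 p.2) :
      Set (TensorSquare H)) := by
  refine UniformSpace.Completion.denseRange_coe.mono ?_
  rintro _ ⟨t, rfl⟩
  induction t using TensorProduct.induction_on with
  | zero => rw [UniformSpace.Completion.coe_zero]; exact zero_mem _
  | tmul x y => exact Submodule.subset_span ⟨(x, y), rfl⟩
  | add s t hs ht => rw [UniformSpace.Completion.coe_add]; exact add_mem hs ht

/-- A bounded operator on the tensor square is determined by its matrix elements between elementary
tensors of vectors from dense sets. -/
theorem tensorSquare_ext_of_dense {H : Type*} [NormedAddCommGroup H] [InnerProductSpace ℂ H]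
    {s t : Set H} (hs : Dense s) (ht : Dense t) {C D : TensorSquare H →L[ℂ] TensorSquare H}
    (h : ∀ a ∈ s, ∀ b ∈ t, ∀ c ∈ s, ∀ d ∈ t,
      ⟪pureTensor a b, C (pureTensor c d)⟫ = ⟪pureTensor a b, D (pureTensor c d)⟫) : C = D := by
  have hst : Dense (s ×ˢ t) := hs.prod ht
  -- Joint continuity first extends the equality from `s ×ˢ t` to all elementary tensors, whose span
  -- is dense; `s` and `t` need not be subspaces.
  have left : ∀ Φ Ψ : TensorSquare H,
      (∀ p ∈ s ×ˢ t, ⟪pureTensor p.1 p.2, Φ⟫ = ⟪pureTensor p.1 p.2, Ψ⟫) → Φ = Ψ := by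
    intro Φ Ψ hp
    have hall : (fun p : H × H => ⟪pureTensor p.1 p.2, Φ⟫) =
        fun p => ⟪pureTensor p.1 p.2, Ψ⟫ :=
      Continuous.ext_on hst (continuous_pureTensor.inner continuous_const)
        (continuous_pureTensor.inner continuous_const) hp
    refine (dense_span_pureTensor H).eq_of_inner_right (𝕜 := ℂ) fun v hv => ?_
    induction hv using Submodule.span_induction with
    | mem _ hx => obtain ⟨p, rfl⟩ := hx; exact congrFun hall p
    | zero => simp
    | add x y _ _ hx hy => rw [inner_add_left, inner_add_left, hx, hy]
    | smul c x _ hx => rw [inner_smul_left, inner_smul_left, hx]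
  have right : (fun p : H × H => C (pureTensor p.1 p.2)) = fun p => D (pureTensor p.1 p.2) :=
    Continuous.ext_on hst (C.continuous.comp continuous_pureTensor)
      (D.continuous.comp continuous_pureTensor)
      fun q hq => left _ _ fun p hp => h p.1 hp.1 p.2 hp.2 q.1 hq.1 q.2 hq.2
  refine ContinuousLinearMap.ext_on (dense_span_pureTensor H) ?_
  rintro _ ⟨p, rfl⟩
  exact congrFun right p

/-- If the adjoint is densely defined, an operator whose adjoint represents the crossing form is
crossing symmetric. -/
theorem ClosedAntilinearInvolution.isCrossingSymmetric_of_forall {H : Type*}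
    [NormedAddCommGroup H] [InnerProductSpace ℂ H] {S : ClosedAntilinearInvolution H}
    (hS : Dense (S.adjointDomain : Set H)) {T : TensorSquare H →L[ℂ] TensorSquare H}
    (h : ∀ (φ₁ : S.domain) (φ₂ : S.adjoint.domain) (ψ₁ : S.domain) (ψ₂ : S.adjoint.domain),
      S.crossingForm T φ₁ φ₂ ψ₁ ψ₂ = ⟪pureTensor (φ₁ : H) (φ₂ : H),
        ContinuousLinearMap.adjoint T (pureTensor (ψ₁ : H) (ψ₂ : H))⟫) :
    S.IsCrossingSymmetric T := by
  have hT : S.IsCrossable T := ⟨_, h⟩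
  refine ⟨hT, tensorSquare_ext_of_dense S.dense_domain hS fun a ha b hb c hc d hd => ?_⟩
  -- The chosen operator and `T*` both represent the crossing form, so their matrix elements agree.
  exact (hT.choose_spec ⟨a, ha⟩ ⟨b, hb⟩ ⟨c, hc⟩ ⟨d, hd⟩).symm.trans
    (h ⟨a, ha⟩ ⟨b, hb⟩ ⟨c, hc⟩ ⟨d, hd⟩)

theorem proposition4 {H : Type*} [NormedAddCommGroup H] [InnerProductSpace ℂ H] [CompleteSpace H]
    (K : StandardSubspace H) (E : ProjectionValuedMeasure H)
    (V : E.support → H →L[ℂ] H) (hV : ∀ x : E.support, V x ∈ K.endomorphisms)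
    (hint : E.TensorIntegrable V) :
    K.tomita.IsCrossingSymmetric (E.tensorIntegral V hint ∘L tensorFlip H) := by
  refine ClosedAntilinearInvolution.isCrossingSymmetric_of_forall K.dense_adjointDomain
    fun φ₁ φ₂ ψ₁ ψ₂ => ?_
  rw [ContinuousLinearMap.adjoint_inner_right, ← inner_conj_symm,
    ClosedAntilinearInvolution.crossingForm]
  -- Both sides reduce to `∫ ⟪φ₂, dE ψ₁⟫ ⟪V(x) φ₁, ψ₂⟫`.
  simp only [ContinuousLinearMap.comp_apply, tensorFlip_pureTensor, E.inner_tensorIntegral,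
    E.conj_sesqIntegral, inner_conj_symm, K.inner_adjoint_map_tomita (hV _)]
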